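/- All graphs are finite, simple and non-empty; $v(G)$ is the number of vertices of $G$. A graph $G$ is a *threshold graph* if there are real weights $(w_i)_{i\in V(G)}$ and a real $t$ such that distinct vertices $i,j$ are adjacent if and only if $w_i+w_j>t$. *Graph limits.* For graphs $F,G$ (where $F$ may also be the graph without vertices) let $t(F,G)$ be the probability that a uniformly random map $V(F)\to V(G)$ is a graph homomorphism. Identify a graph $G$ with the point $\bigl((t(F,G))_F,\,1/v(G)\bigr)$ of the product space $\mathbb R^{\{F\}}\times\mathbb R$, and let $\overline{\mathcal U}$ be the closure of the set of all these points; convergence of graphs in $\overline{\mathcal U}$ is convergence of these points to a point of $\overline{\mathcal U}$. (If $v(G_n)\to\infty$, it amounts to the convergence of $t(F,G_n)$ for every graph $F$.) For a symmetric measurable function $W:[0,1]^2\to[0,1]$, let $\Gamma_W$ be the point whose $F$-coordinate is $$t(F,\Gamma_W)=\int_{[0,1]^{V(F)}}\prod_{ij\in E(F)}W(x_i,x_j)\prod_{i\in V(F)}dx_i$$ for every $F$, and whose last coordinate is $0$. *Degree distributions.* Let $\mathcal P$ be the set of Borel probability measures on $[0,1]$ with the topology of weak convergence, and let $\nu(G)\in\mathcal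 P$ be the distribution of $d_G(v)/v(G)$, where $d_G(v)$ is the degree of a uniformly random vertex $v$ of $G$. *Reflection.* For $\mu\in\mathcal P$ let $F_\mu(x-)=\mu([0,x))$, let $$S_\mu=\{(x,y)\in[0,1]^2: x\ge F_\mu((1-y)-)\},$$ and let $W_\mu=\mathbf 1_{S_\mu}$. For $S\subseteq[0,1]^2$ let $S^\dagger=\{(x,y):(y,x)\in S\}$, and let $\mu^\dagger$ be the unique element of $\mathcal P$ with $S_{\mu^\dagger}=(S_\mu)^\dagger$. Let $\mathcal P_{\mathsf s}=\{\mu\in\mathcal P:\mu^\dagger=\mu\}$. For $\mu\in\mathcal P_{\mathsf s}$ the function $W_\mu$ is symmetric; write $\Gamma_\mu=\Gamma_{W_\mu}$. **Theorem 5.6.** Let $G_n$ be a sequence of threshold graphs such that $v(G_n)\to\infty$. Then $G_n$ converges in $\overline{\mathcal U}$ as $n\to\infty$ if and only if the degree distributions $\nu(G_n)$ converge in $\mathcal P$ to some $\mu\in\mathcal P$. In this case, $\mu\in\mathcal P_{\mathsf s}$ and $G_n\to\Gamma_\mu$ in $\overline{\mathcal U}$. -/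

import Mathlib

open MeasureTheory Set Filter Topology

noncomputable section

/-! ### Threshold graphs -/

/-- `G` is a threshold graph: there are real vertex weights and a threshold `t` such that two
distinct vertices are adjacent exactly when the sum of their weights exceeds `t`. -/
def IsThresholdGraph {V : Type*} (G : SimpleGraph V) : Prop :=
  ∃ (w : V → ℝ) (t : ℝ), ∀ i j : V, i ≠ j → (G.Adj i j ↔ w i + w j > t)

/-! ### Homomorphism densities and the compactification of the set of graphs -/

/-- The finite graphs `F` (on the vertex sets `Fin k`) that index the functionals `t(F, ·)`. -/
abbrev TestGraph : Type := Σ k : ℕ, SimpleGraph (Fin k)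

/-- `t(F, G)`: the probability that a uniformly random map `V(F) → V(G)` is a graph
homomorphism. -/
def homDensity (F : TestGraph) {V : Type*} [Fintype V] (G : SimpleGraph V) : ℝ :=
  (Nat.card (F.2 →g G) : ℝ) / (Fintype.card V : ℝ) ^ F.1

/-- The ambient space of the compactification, with the product topology. A point records the
values of all the functionals `t(F, ·)` and of `1 / v(·)`. -/
abbrev GraphSpace : Type := (TestGraph → ℝ) × ℝ

/-- The point `((t(F, G))_F, 1 / v(G))` that represents the finite graph `G`. It determines `G` up
to isomorphism. -/
def graphPoint {V : Type*} [Fintype V] (G : SimpleGraph V) : GraphSpace :=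
  (fun F => homDensity F G, 1 / (Fintype.card V : ℝ))

/-- The compactification of the set of finite nonempty unlabeled graphs: the closure of the set of
all points that represent graphs. -/
def graphCompletion : Set GraphSpace :=
  closure {p | ∃ (n : ℕ) (G : SimpleGraph (Fin (n + 1))), p = graphPoint G}

/-- The graphs `G n` converge to `Γ` in the compactification. -/
def GraphsConvergeTo {V : ℕ → Type*} [∀ n, Fintype (V n)] (G : ∀ n, SimpleGraph (V n))
    (Γ : GraphSpace) : Prop :=
  Γ ∈ graphCompletion ∧ Tendsto (fun n => graphPoint (G n)) atTop (𝓝 Γ)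

open Classical in
/-- `t(F, Γ_W)`: the integral over `x ∈ [0,1]^{V(F)}` of the product of `W(x_i, x_j)` over all
edges `ij` of `F` (each edge is taken once, with `i < j`; this is immaterial for symmetric `W`). -/
def kernelDensity (F : TestGraph) (W : unitInterval → unitInterval → ℝ) : ℝ :=
  ∫ x : Fin F.1 → unitInterval,
    ∏ e : Fin F.1 × Fin F.1 with e.1 < e.2 ∧ F.2.Adj e.1 e.2, W (x e.1) (x e.2)

/-- The graph limit `Γ_W` represented by `W`; graph limits are the points with `1 / v = 0`. -/
def kernelLimit (W : unitInterval → unitInterval → ℝ) : GraphSpace :=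
  (fun F => kernelDensity F W, 0)

/-! ### Degree distributions -/

open Classical in
/-- `d_G(v) / v(G)`, as a point of `[0,1]`. -/
def normalizedDegree {V : Type*} [Fintype V] (G : SimpleGraph V) (v : V) : unitInterval :=
  ⟨(G.degree v : ℝ) / (Fintype.card V : ℝ), by
    refine ⟨by positivity, div_le_one_of_le₀ ?_ (by positivity)⟩
    exact_mod_cast (G.degree_lt_card_verts v).le⟩

/-- `ν(G)`: the law of `d_G(v) / v(G)` for a uniformly random vertex `v`. -/
def degreeDistribution {V : Type*} [Fintype V] [Nonempty V] (G : SimpleGraph V) :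
    ProbabilityMeasure unitInterval :=
  ⟨((PMF.uniformOfFintype V).map (normalizedDegree G)).toMeasure, inferInstance⟩

/-! ### The sets `S_μ` and the reflection of measures -/

/-- `F_μ(x-) = μ([0,x))`. -/
def leftCdf (μ : ProbabilityMeasure unitInterval) (x : unitInterval) : ℝ :=
  ((μ (Iio x) : NNReal) : ℝ)

/-- `S_μ = {(x,y) ∈ [0,1]² : x ≥ F_μ((1-y)-)}`. -/
def thresholdSet (μ : ProbabilityMeasure unitInterval) : Set (unitInterval × unitInterval) :=
  {p | leftCdf μ (unitInterval.symm p.2) ≤ (p.1 : ℝ)}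

/-- `W_μ`, the indicator function of `S_μ`. -/
def thresholdKernel (μ : ProbabilityMeasure unitInterval) (x y : unitInterval) : ℝ :=
  (thresholdSet μ).indicator (fun _ => 1) (x, y)

/-- `Γ_μ = Γ(W_μ)`. -/
def thresholdLimit (μ : ProbabilityMeasure unitInterval) : GraphSpace :=
  kernelLimit (thresholdKernel μ)

/-- `S† = {(x,y) : (y,x) ∈ S}`. -/
def reflectSet (S : Set (unitInterval × unitInterval)) : Set (unitInterval × unitInterval) :=
  {p | (p.2, p.1) ∈ S}

theorem leftCdf_eq (μ : ProbabilityMeasure unitInterval) (x : unitInterval) :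
    leftCdf μ x = (μ : Measure unitInterval).real (Iio x) := rfl

theorem leftCdf_mem (μ : ProbabilityMeasure unitInterval) (x : unitInterval) :
    leftCdf μ x ∈ Icc (0 : ℝ) 1 :=
  ⟨by rw [leftCdf_eq]; positivity, by rw [leftCdf_eq]; exact measureReal_le_one⟩

theorem leftCdf_mono (μ : ProbabilityMeasure unitInterval) : Monotone (leftCdf μ) := by
  intro x y h
  rw [leftCdf_eq, leftCdf_eq]
  exact measureReal_mono (Iio_subset_Iio h)

theorem thresholdSet_injective : Function.Injective thresholdSet := by
  intro μ μ' h
  have key : ∀ x, leftCdf μ x = leftCdf μ' x := by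
    intro x
    have h1 := fun z : unitInterval => Set.ext_iff.1 h (z, unitInterval.symm x)
    simp only [thresholdSet, mem_ofPred_eq, unitInterval.symm_symm] at h1
    apply le_antisymm
    · exact (h1 ⟨_, leftCdf_mem μ' x⟩).2 le_rfl
    · exact (h1 ⟨_, leftCdf_mem μ x⟩).1 le_rfl
  have hm : (μ : Measure unitInterval) = (μ' : Measure unitInterval) := by
    refine ext_of_generate_finite (range (Iio : unitInterval → Set unitInterval))
      (borel_eq_generateFrom_Iio unitInterval ▸ BorelSpace.measurable_eq) isPiSystem_Iio ?_
      (by simp)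
    rintro _ ⟨x, rfl⟩
    have := key x
    rw [leftCdf_eq, leftCdf_eq] at this
    exact (measureReal_eq_measureReal_iff).1 this
  exact Subtype.ext hm

/-- The set `(S_μ)†` is again of the form `S_μ'`. -/
theorem exists_reflection (μ : ProbabilityMeasure unitInterval) :
    ∃ μ' : ProbabilityMeasure unitInterval, thresholdSet μ' = reflectSet (thresholdSet μ) := by
  let g : unitInterval → unitInterval := fun y =>
    unitInterval.symm ⟨leftCdf μ (unitInterval.symm y), leftCdf_mem μ _⟩
  have hg : Monotone g := by
    intro a b hab
    simp only [g]
    rw [unitInterval.symm_le_symm]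
    exact leftCdf_mono μ (unitInterval.symm_le_symm.2 hab)
  let ν : ProbabilityMeasure unitInterval :=
    ⟨Measure.map g volume, Measure.isProbabilityMeasure_map hg.measurable.aemeasurable⟩
  have hν : ∀ s, leftCdf ν s = (volume : Measure unitInterval).real (g ⁻¹' Iio s) := by
    intro s
    have h : leftCdf ν s = (Measure.map g volume).real (Iio s) := rfl
    rw [h, map_measureReal_apply hg.measurable measurableSet_Iio]
  refine ⟨ν, ?_⟩
  have hleft : ∀ (s : unitInterval) (c : ℝ), 0 ≤ c → c < leftCdf μ s →
      ∃ r, r < s ∧ c < leftCdf μ r := by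
    intro s c hc hs
    have hs0 : (0 : unitInterval) < s := by
      refine lt_of_le_of_ne unitInterval.nonneg' fun h => ?_
      have h0 : Iio (0 : unitInterval) = ∅ :=
        Set.eq_empty_of_forall_notMem fun z hz => not_lt.2 unitInterval.nonneg' hz
      rw [leftCdf_eq, ← h, h0, measureReal_empty] at hs
      exact absurd hs (not_lt.2 hc)
    obtain ⟨u, hu, hus, hut⟩ := exists_seq_strictMono_tendsto' hs0
    have hU : ⋃ n, Iio (u n) = Iio s := by
      ext z
      simp only [mem_iUnion, mem_Iio]
      exact ⟨fun ⟨n, hn⟩ => hn.trans (hus n).2,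
        fun hz => (hut.eventually (lt_mem_nhds hz)).exists⟩
    have ht : Tendsto (fun n => leftCdf μ (u n)) atTop (𝓝 (leftCdf μ s)) := by
      have h1 := tendsto_measure_iUnion_atTop (μ := (μ : Measure unitInterval))
        (s := fun n => Iio (u n)) (fun a b hab => Iio_subset_Iio (hu.monotone hab))
      rw [hU] at h1
      exact (ENNReal.tendsto_toReal (measure_ne_top _ _)).comp h1
    obtain ⟨n, hn⟩ := (ht.eventually (lt_mem_nhds hs)).exists
    exact ⟨u n, (hus n).2, hn⟩
  have hgc : ∀ a b : unitInterval,
      g a < unitInterval.symm b ↔ (b : ℝ) < leftCdf μ (unitInterval.symm a) := by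
    intro a b
    simp only [g]
    rw [unitInterval.symm_lt_symm, ← Subtype.coe_lt_coe]
  ext ⟨x, y⟩
  simp only [thresholdSet, reflectSet, mem_ofPred_eq]
  rw [hν]
  constructor
  · intro h
    by_contra! hlt
    obtain ⟨r, hr, hyr⟩ := hleft _ _ unitInterval.nonneg' hlt
    have hsub : Iic (unitInterval.symm r) ⊆ g ⁻¹' Iio (unitInterval.symm y) := by
      intro z hz
      refine (hg hz).trans_lt ((hgc _ _).2 ?_)
      rwa [unitInterval.symm_symm]
    have h2 := (measureReal_mono (μ := volume) hsub).trans h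
    rw [measureReal_def, unitInterval.volume_Iic, ENNReal.toReal_ofReal unitInterval.nonneg',
      Subtype.coe_le_coe] at h2
    have h3 := unitInterval.symm_le_symm.2 h2
    rw [unitInterval.symm_symm] at h3
    exact absurd hr (not_lt.2 h3)
  · intro h
    have hsub : g ⁻¹' Iio (unitInterval.symm y) ⊆ Iio x := by
      intro z hz
      rw [mem_Iio]
      by_contra! hxz
      exact absurd ((hgc _ _).1 ((hg hxz).trans_lt hz)) (not_lt.2 h)
    refine (measureReal_mono (μ := volume) hsub).trans ?_
    rw [measureReal_def, unitInterval.volume_Iio, ENNReal.toReal_ofReal unitInterval.nonneg']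

theorem existsUnique_reflection (μ : ProbabilityMeasure unitInterval) :
    ∃! μ' : ProbabilityMeasure unitInterval, thresholdSet μ' = reflectSet (thresholdSet μ) := by
  obtain ⟨μ', h⟩ := exists_reflection μ
  exact ⟨μ', h, fun ν hν => thresholdSet_injective (hν.trans h.symm)⟩

/-- The reflection `μ†` of `μ`: the unique probability measure with `S_{μ†} = (S_μ)†`. -/
def reflectMeasure (μ : ProbabilityMeasure unitInterval) : ProbabilityMeasure unitInterval :=
  (existsUnique_reflection μ).choose

/-- The set of probability measures on `[0,1]` with `μ† = μ`. -/
def symmetricMeasures : Set (ProbabilityMeasure unitInterval) :=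
  {μ | reflectMeasure μ = μ}

end

theorem measurePreserving_pair {n : ℕ} {i j : Fin n} (h : i ≠ j) :
    MeasurePreserving (fun x : Fin n → unitInterval => (x i, x j)) volume volume := by
  refine ⟨by fun_prop, ?_⟩
  have hind := (ProbabilityTheory.iIndepFun_pi (μ := fun _ : Fin n => (volume : Measure unitInterval))
    (X := fun _ => id) (fun _ => aemeasurable_id)).indepFun h
  have := (ProbabilityTheory.indepFun_iff_map_prod_eq_prod_map_map
    (measurable_pi_apply i).aemeasurable (measurable_pi_apply j).aemeasurable).1 hind
  rw [volume_pi, this]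
  have h1 : ∀ i : Fin n, Measure.map (fun x : Fin n → unitInterval => x i)
      (Measure.pi fun _ => volume) = volume := fun i =>
    (measurePreserving_eval (fun _ : Fin n => (volume : Measure unitInterval)) i).map_eq
  rw [h1, h1, Measure.volume_eq_prod]

theorem abs_prod_sub_prod_le {ι : Type*} (s : Finset ι) {a b : ι → ℝ}
    (ha : ∀ i, a i ∈ Icc (0 : ℝ) 1) (hb : ∀ i, b i ∈ Icc (0 : ℝ) 1) :
    |∏ i ∈ s, a i - ∏ i ∈ s, b i| ≤ ∑ i ∈ s, |a i - b i| := by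
  classical
  induction s using Finset.induction_on with
  | empty => simp
  | insert i s hi ih =>
    rw [Finset.prod_insert hi, Finset.prod_insert hi, Finset.sum_insert hi]
    have hA : |∏ i ∈ s, a i| ≤ 1 := by
      rw [Finset.abs_prod]
      exact Finset.prod_le_one (fun _ _ => abs_nonneg _)
        fun i _ => by rw [abs_of_nonneg (ha i).1]; exact (ha i).2
    have hB : |b i| ≤ 1 := by rw [abs_of_nonneg (hb i).1]; exact (hb i).2
    calc |a i * ∏ i ∈ s, a i - b i * ∏ i ∈ s, b i|
        = |(a i - b i) * ∏ i ∈ s, a i + b i * (∏ i ∈ s, a i - ∏ i ∈ s, b i)| := by ring_nf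
      _ ≤ |a i - b i| * |∏ i ∈ s, a i| + |b i| * |∏ i ∈ s, a i - ∏ i ∈ s, b i| := by
        rw [← abs_mul, ← abs_mul]; exact abs_add_le _ _
      _ ≤ |a i - b i| * 1 + 1 * ∑ i ∈ s, |a i - b i| := by gcongr
      _ = _ := by ring

/-- A measurable kernel with values in `[0,1]`. -/
structure IsKernel (W : unitInterval → unitInterval → ℝ) : Prop where
  measurable : Measurable (Function.uncurry W)
  mem_Icc : ∀ x y, W x y ∈ Icc (0 : ℝ) 1

/-- The `L¹` distance of two kernels. -/
noncomputable def kernelDist (U W : unitInterval → unitInterval → ℝ) : ℝ :=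
  ∫ p : unitInterval × unitInterval, |U p.1 p.2 - W p.1 p.2|

namespace IsKernel

variable {U W X : unitInterval → unitInterval → ℝ}

theorem flip (hW : IsKernel W) : IsKernel fun x y => W y x :=
  ⟨hW.measurable.comp measurable_swap, fun x y => hW.mem_Icc y x⟩

theorem measurable_comp (hW : IsKernel W) {Ω : Type*} [MeasurableSpace Ω]
    {f g : Ω → unitInterval} (hf : Measurable f) (hg : Measurable g) :
    Measurable fun ω => W (f ω) (g ω) :=
  hW.measurable.comp (hf.prodMk hg)

theorem measurable_abs_sub (hU : IsKernel U) (hW : IsKernel W) :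
    Measurable fun p : unitInterval × unitInterval => |U p.1 p.2 - W p.1 p.2| :=
  ((hU.measurable_comp measurable_fst measurable_snd).sub
    (hW.measurable_comp measurable_fst measurable_snd)).abs

theorem abs_sub_le_one (hU : IsKernel U) (hW : IsKernel W) (x y : unitInterval) :
    |U x y - W x y| ≤ 1 := by
  have h1 := hU.mem_Icc x y
  have h2 := hW.mem_Icc x y
  rw [abs_le]
  constructor <;> linarith [h1.1, h1.2, h2.1, h2.2]

theorem integrable_abs_sub (hU : IsKernel U) (hW : IsKernel W) :
    Integrable fun p : unitInterval × unitInterval => |U p.1 p.2 - W p.1 p.2| :=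
  .of_bound (hU.measurable_abs_sub hW).aestronglyMeasurable 1
    (ae_of_all _ fun p => by rw [Real.norm_eq_abs, abs_abs]; exact hU.abs_sub_le_one hW _ _)

theorem kernelDist_triangle (hU : IsKernel U) (hW : IsKernel W) (hX : IsKernel X) :
    kernelDist U X ≤ kernelDist U W + kernelDist W X := by
  unfold kernelDist
  rw [← integral_add (hU.integrable_abs_sub hW) (hW.integrable_abs_sub hX)]
  exact integral_mono (hU.integrable_abs_sub hX)
    ((hU.integrable_abs_sub hW).add (hW.integrable_abs_sub hX)) fun p => abs_sub_le _ _ _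

end IsKernel

theorem kernelDist_nonneg (U W : unitInterval → unitInterval → ℝ) : 0 ≤ kernelDist U W :=
  integral_nonneg fun _ => abs_nonneg _

theorem kernelDist_comm (U W : unitInterval → unitInterval → ℝ) :
    kernelDist U W = kernelDist W U := by
  simp only [kernelDist, abs_sub_comm]

theorem kernelDist_flip (U W : unitInterval → unitInterval → ℝ) :
    kernelDist (fun x y => U y x) (fun x y => W y x) = kernelDist U W := by
  unfold kernelDist
  exact integral_prod_swap (μ := volume) (ν := volume)
    fun p : unitInterval × unitInterval => |U p.1 p.2 - W p.1 p.2|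

theorem exists_abs_kernelDensity_sub_le (F : TestGraph) :
    ∃ C : ℝ, ∀ U W, IsKernel U → IsKernel W →
      |kernelDensity F U - kernelDensity F W| ≤ C * kernelDist U W := by
  classical
  refine ⟨(Finset.univ.filter fun e : Fin F.1 × Fin F.1 =>
    e.1 < e.2 ∧ F.2.Adj e.1 e.2).card, fun U W hU hW => ?_⟩
  have hint : ∀ {W}, IsKernel W → Integrable fun x : Fin F.1 → unitInterval =>
      ∏ e : Fin F.1 × Fin F.1 with e.1 < e.2 ∧ F.2.Adj e.1 e.2, W (x e.1) (x e.2) := by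
    intro W hW
    refine .of_bound (Finset.measurable_prod _ fun e _ => hW.measurable_comp
      (measurable_pi_apply e.1) (measurable_pi_apply e.2)).aestronglyMeasurable 1
      (ae_of_all _ fun x => ?_)
    rw [Real.norm_eq_abs, Finset.abs_prod]
    refine Finset.prod_le_one (fun _ _ => abs_nonneg _) fun e _ => ?_
    rw [abs_of_nonneg (hW.mem_Icc _ _).1]
    exact (hW.mem_Icc _ _).2
  have hpair : ∀ e : Fin F.1 × Fin F.1, e.1 < e.2 →
      Integrable (fun x : Fin F.1 → unitInterval => |U (x e.1) (x e.2) - W (x e.1) (x e.2)|) ∧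
      ∫ x : Fin F.1 → unitInterval, |U (x e.1) (x e.2) - W (x e.1) (x e.2)| =
        kernelDist U W := by
    intro e he
    have hmp := measurePreserving_pair he.ne
    refine ⟨hmp.integrable_comp_of_integrable (hU.integrable_abs_sub hW), ?_⟩
    unfold kernelDist
    rw [← hmp.map_eq, integral_map hmp.measurable.aemeasurable
      (hU.measurable_abs_sub hW).aestronglyMeasurable]
  have hsum := integrable_finsetSum (μ := (volume : Measure (Fin F.1 → unitInterval)))
    (Finset.univ.filter fun e : Fin F.1 × Fin F.1 => e.1 < e.2 ∧ F.2.Adj e.1 e.2)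
    (fun e he => (hpair e (Finset.mem_filter.1 he).2.1).1)
  unfold kernelDensity
  convert_to |(∫ x : Fin F.1 → unitInterval, ∏ e : Fin F.1 × Fin F.1 with e.1 < e.2 ∧
    F.2.Adj e.1 e.2, U (x e.1) (x e.2)) - ∫ x : Fin F.1 → unitInterval,
    ∏ e : Fin F.1 × Fin F.1 with e.1 < e.2 ∧ F.2.Adj e.1 e.2, W (x e.1) (x e.2)| ≤ _
  rw [← integral_sub (hint hU) (hint hW)]
  calc _ ≤ ∫ x : Fin F.1 → unitInterval, |(∏ e : Fin F.1 × Fin F.1 with e.1 < e.2 ∧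
        F.2.Adj e.1 e.2, U (x e.1) (x e.2)) -
        ∏ e : Fin F.1 × Fin F.1 with e.1 < e.2 ∧ F.2.Adj e.1 e.2, W (x e.1) (x e.2)| :=
        abs_integral_le_integral_abs
    _ ≤ ∫ x : Fin F.1 → unitInterval, ∑ e : Fin F.1 × Fin F.1 with e.1 < e.2 ∧
        F.2.Adj e.1 e.2, |U (x e.1) (x e.2) - W (x e.1) (x e.2)| :=
        integral_mono ((hint hU).sub (hint hW)).abs hsum fun x =>
          abs_prod_sub_prod_le _ (fun e => hU.mem_Icc _ _) fun e => hW.mem_Icc _ _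
    _ = _ := by
        rw [integral_finsetSum _ fun e he => (hpair e (Finset.mem_filter.1 he).2.1).1,
          Finset.sum_congr rfl fun e he => (hpair e (Finset.mem_filter.1 he).2.1).2]
        simp

theorem isKernel_thresholdKernel (μ : ProbabilityMeasure unitInterval) :
    IsKernel (thresholdKernel μ) := by
  refine ⟨?_, fun x y => ?_⟩
  · have hS : MeasurableSet (thresholdSet μ) :=
      measurableSet_le ((leftCdf_mono μ).measurable.comp
        (unitInterval.measurable_symm.comp measurable_snd))
        (measurable_subtype_coe.comp measurable_fst)
    exact measurable_const.indicator hS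
  · unfold thresholdKernel
    by_cases h : (x, y) ∈ thresholdSet μ <;> simp [h]

theorem thresholdKernel_eq_ite (μ : ProbabilityMeasure unitInterval) (x y : unitInterval)
    [Decidable (leftCdf μ (unitInterval.symm y) ≤ x)] :
    thresholdKernel μ x y = if leftCdf μ (unitInterval.symm y) ≤ x then 1 else 0 := by
  simp [thresholdKernel, thresholdSet, indicator_apply]

theorem tendsto_leftCdf {ν : ℕ → ProbabilityMeasure unitInterval}
    {μ : ProbabilityMeasure unitInterval} (h : Tendsto ν atTop (𝓝 μ)) {s : unitInterval}
    (hs : (μ : Measure unitInterval) {s} = 0) :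
    Tendsto (fun n => leftCdf (ν n) s) atTop (𝓝 (leftCdf μ s)) := by
  have h0 : μ (frontier (Iio s)) = 0 := by
    have : (μ : Measure unitInterval) (frontier (Iio s)) = 0 :=
      by
      refine measure_mono_null ?_ hs
      rw [isOpen_Iio.frontier_eq]
      exact fun x hx => le_antisymm (closure_minimal Iio_subset_Iic_self isClosed_Iic hx.1) (not_lt.1 hx.2)
    exact (ProbabilityMeasure.null_iff_toMeasure_null _ _).2 this
  exact (NNReal.continuous_coe.tendsto _).comp
    (ProbabilityMeasure.tendsto_measure_of_null_frontier_of_tendsto h h0)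

theorem countable_atoms {α : Type*} [MeasurableSpace α] [MeasurableSingletonClass α]
    (μ : Measure α) [SFinite μ] : {x | μ {x} ≠ 0}.Countable := by
  have := Measure.countable_meas_pos_of_disjoint_iUnion (μ := μ) (As := fun x : α => {x})
    (fun x => measurableSet_singleton x) (fun x y h => by simpa [Function.onFun] using h)
  simpa [pos_iff_ne_zero] using this

theorem tendsto_kernelDist_thresholdKernel {ν : ℕ → ProbabilityMeasure unitInterval}
    {μ : ProbabilityMeasure unitInterval} (h : Tendsto ν atTop (𝓝 μ)) :
    Tendsto (fun n => kernelDist (thresholdKernel (ν n)) (thresholdKernel μ)) atTop (𝓝 0) := by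
  classical
  have hlim : Tendsto (fun n => kernelDist (thresholdKernel (ν n)) (thresholdKernel μ)) atTop
      (𝓝 (∫ _ : unitInterval × unitInterval, (0 : ℝ))) := by
    refine tendsto_integral_of_dominated_convergence (fun _ => 1)
      (fun n => ((isKernel_thresholdKernel _).measurable_abs_sub
        (isKernel_thresholdKernel _)).aestronglyMeasurable) (integrable_const _)
      (fun n => ae_of_all _ fun p => by
        rw [Real.norm_eq_abs, abs_abs]
        exact (isKernel_thresholdKernel _).abs_sub_le_one (isKernel_thresholdKernel _) _ _) ?_
    have h1 : ∀ᵐ y : unitInterval,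
        (μ : Measure unitInterval) {unitInterval.symm y} = 0 := by
      have hc : {y : unitInterval | (μ : Measure unitInterval) {unitInterval.symm y} ≠ 0}.Countable :=
        (countable_atoms (μ : Measure unitInterval)).preimage
          unitInterval.symm_bijective.injective
      exact hc.measure_zero volume
    have h2 : ∀ᵐ p : unitInterval × unitInterval,
        (μ : Measure unitInterval) {unitInterval.symm p.2} = 0 :=
      Measure.quasiMeasurePreserving_snd.ae h1
    have h3 : ∀ᵐ p : unitInterval × unitInterval,
        leftCdf μ (unitInterval.symm p.2) ≠ p.1 := by
      have hm : MeasurableSet {p : unitInterval × unitInterval |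
          leftCdf μ (unitInterval.symm p.1) = p.2} :=
        measurableSet_eq_fun ((leftCdf_mono μ).measurable.comp
        (unitInterval.measurable_symm.comp measurable_fst))
        (measurable_subtype_coe.comp measurable_snd)
      have h4 : ∀ᵐ p : unitInterval × unitInterval,
          leftCdf μ (unitInterval.symm p.1) ≠ p.2 := by
        rw [ae_iff]
        simp only [ne_eq, not_not]
        rw [Measure.volume_eq_prod, Measure.measure_prod_null hm]
        refine ae_of_all _ fun x => ?_
        refine Set.Subsingleton.measure_zero (fun a ha b hb => ?_) _
        exact Subtype.ext ((show _ = _ from ha).symm.trans hb)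
      exact (Measure.measurePreserving_swap (μ := (volume : Measure unitInterval))
        (ν := (volume : Measure unitInterval))).quasiMeasurePreserving.ae h4
    filter_upwards [h2, h3] with p hp2 hp3
    have ht := tendsto_leftCdf h hp2
    refine tendsto_const_nhds.congr' ?_
    rcases lt_or_gt_of_ne hp3 with hlt | hgt
    · filter_upwards [ht.eventually (gt_mem_nhds hlt)] with n hn
      simp [thresholdKernel_eq_ite, hn.le, hlt.le]
    · filter_upwards [ht.eventually (lt_mem_nhds hgt)] with n hn
      simp [thresholdKernel_eq_ite, not_le.2 hn, not_le.2 hgt]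
  simpa using hlim

theorem exists_lt_lt_leftCdf {μ : ProbabilityMeasure unitInterval} {s : unitInterval} {c : ℝ}
    (hc : 0 ≤ c) (hs : c < leftCdf μ s) : ∃ r, r < s ∧ c < leftCdf μ r := by
  have hs0 : (0 : unitInterval) < s := by
    refine lt_of_le_of_ne unitInterval.nonneg' fun h => ?_
    have h0 : Iio (0 : unitInterval) = ∅ :=
      Set.eq_empty_of_forall_notMem fun z hz => not_lt.2 unitInterval.nonneg' hz
    rw [leftCdf_eq, ← h, h0, measureReal_empty] at hs
    exact absurd hs (not_lt.2 hc)
  obtain ⟨u, hu, hus, hut⟩ := exists_seq_strictMono_tendsto' hs0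
  have hU : ⋃ n, Iio (u n) = Iio s := by
    ext z
    simp only [mem_iUnion, mem_Iio]
    exact ⟨fun ⟨n, hn⟩ => hn.trans (hus n).2,
      fun hz => (hut.eventually (lt_mem_nhds hz)).exists⟩
  have ht : Tendsto (fun n => leftCdf μ (u n)) atTop (𝓝 (leftCdf μ s)) := by
    have h1 := tendsto_measure_iUnion_atTop (μ := (μ : Measure unitInterval))
      (s := fun n => Iio (u n)) (fun a b hab => Iio_subset_Iio (hu.monotone hab))
    rw [hU] at h1
    exact (ENNReal.tendsto_toReal (measure_ne_top _ _)).comp h1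
  obtain ⟨n, hn⟩ := (ht.eventually (lt_mem_nhds hs)).exists
  exact ⟨u n, (hus n).2, hn⟩

theorem mem_symmetricMeasures_of_kernelDist_eq_zero {μ : ProbabilityMeasure unitInterval}
    (h : kernelDist (thresholdKernel μ) (fun x y => thresholdKernel μ y x) = 0) :
    μ ∈ symmetricMeasures := by
  classical
  have hW := isKernel_thresholdKernel μ
  have hae : ∀ᵐ p : unitInterval × unitInterval,
      thresholdKernel μ p.1 p.2 = thresholdKernel μ p.2 p.1 := by
    have := (integral_eq_zero_iff_of_nonneg (fun _ => abs_nonneg _)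
      (hW.integrable_abs_sub hW.flip)).1 h
    filter_upwards [this] with p hp
    exact sub_eq_zero.1 (abs_eq_zero.1 hp)
  have key : ∀ x y : unitInterval, leftCdf μ (unitInterval.symm y) ≤ x →
      leftCdf μ (unitInterval.symm x) ≤ y := by
    intro x y hxy
    by_contra! hlt
    obtain ⟨r, hr, hyr⟩ := exists_lt_lt_leftCdf unitInterval.nonneg' hlt
    have hsub : Ioo x (unitInterval.symm r) ×ˢ Ioo y ⟨leftCdf μ r, leftCdf_mem μ r⟩ ⊆
        {p : unitInterval × unitInterval |
          ¬ thresholdKernel μ p.1 p.2 = thresholdKernel μ p.2 p.1} := by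
      rintro ⟨x', y'⟩ ⟨⟨hx1, hx2⟩, hy1, hy2⟩
      have h1 : leftCdf μ (unitInterval.symm y') ≤ x' :=
        (leftCdf_mono μ (unitInterval.symm_le_symm.2 hy1.le)).trans (hxy.trans hx1.le)
      have h2 : (y' : ℝ) < leftCdf μ (unitInterval.symm x') := by
        refine lt_of_lt_of_le (Subtype.coe_lt_coe.2 hy2) (leftCdf_mono μ ?_)
        have := unitInterval.symm_le_symm.2 hx2.le
        rwa [unitInterval.symm_symm] at this
      simp [thresholdKernel_eq_ite, h1, not_le.2 h2]
    have h0 := measure_mono_null hsub (ae_iff.1 hae)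
    rw [Measure.volume_eq_prod, Measure.prod_prod, mul_eq_zero] at h0
    have hx : x < unitInterval.symm r := by
      have := unitInterval.symm_lt_symm.2 hr
      rwa [unitInterval.symm_symm] at this
    rcases h0 with h0 | h0
    · rw [unitInterval.volume_Ioo, ENNReal.ofReal_eq_zero, sub_nonpos] at h0
      exact absurd hx (not_lt.2 h0)
    · rw [unitInterval.volume_Ioo, ENNReal.ofReal_eq_zero, sub_nonpos] at h0
      exact absurd hyr (not_lt.2 h0)
  refine (existsUnique_reflection μ).unique (existsUnique_reflection μ).choose_spec.1 ?_
  ext ⟨x, y⟩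
  exact ⟨key x y, key y x⟩

/-! ### The uniform coupling of `[0,1]` with `Fin N` -/

/-- The index of the interval `[i/N, (i+1)/N)` that contains `x`. -/
noncomputable def stepIndex (N : ℕ) [NeZero N] (x : unitInterval) : Fin N :=
  Fin.ofNat N ⌊(N : ℝ) * x⌋₊

section stepIndex

variable {N : ℕ} [NeZero N]

theorem measurable_stepIndex : Measurable (stepIndex N) :=
  (measurable_of_countable (Fin.ofNat N)).comp
    (Nat.measurable_floor.comp (measurable_subtype_coe.const_mul (N : ℝ)))

theorem stepIndex_val {x : unitInterval} (hx : x ≠ 1) :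
    (stepIndex N x : ℕ) = ⌊(N : ℝ) * x⌋₊ := by
  have hN : (0 : ℝ) < N := by exact_mod_cast NeZero.pos N
  have hx1 : (x : ℝ) < 1 := lt_of_le_of_ne x.2.2 fun h => hx (Subtype.ext h)
  refine Nat.mod_eq_of_lt ((Nat.floor_lt (mul_nonneg hN.le x.2.1)).2 ?_)
  nlinarith

theorem ae_ne_one : ∀ᵐ x : unitInterval, x ≠ 1 := by
  simp [ae_iff]

theorem volume_stepIndex_preimage (i : Fin N) :
    (volume : Measure unitInterval).real (stepIndex N ⁻¹' {i}) = 1 / N := by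
  have hN : (0 : ℝ) < N := by exact_mod_cast NeZero.pos N
  have hi : ((i : ℕ) : ℝ) + 1 ≤ N := by exact_mod_cast i.2
  let a : unitInterval := ⟨i / N, by positivity, by rw [div_le_one hN]; linarith⟩
  let b : unitInterval := ⟨(i + 1) / N, by positivity, by rwa [div_le_one hN]⟩
  have hae : stepIndex N ⁻¹' {i} =ᵐ[volume] Ico a b := by
    filter_upwards [ae_ne_one] with x hx
    refine propext (?_ : stepIndex N x = i ↔ a ≤ x ∧ x < b)
    rw [Fin.ext_iff, stepIndex_val hx, Nat.floor_eq_iff (mul_nonneg hN.le x.2.1),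
      ← Subtype.coe_le_coe, ← Subtype.coe_lt_coe, div_le_iff₀ hN, lt_div_iff₀ hN, mul_comm (N : ℝ)]
  have hab : (b : ℝ) - a = 1 / N := by simp only [a, b]; ring
  rw [measureReal_def, measure_congr hae, unitInterval.volume_Ico, hab,
    ENNReal.toReal_ofReal (by positivity)]

/-- The uniform distribution on `Fin N`. -/
noncomputable def uniformFin (N : ℕ) [NeZero N] : Measure (Fin N) :=
  Measure.map (stepIndex N) volume

instance : IsProbabilityMeasure (uniformFin N) :=
  Measure.isProbabilityMeasure_map measurable_stepIndex.aemeasurable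

theorem measurePreserving_stepIndex : MeasurePreserving (stepIndex N) volume (uniformFin N) :=
  ⟨measurable_stepIndex, rfl⟩

theorem uniformFin_real_singleton (i : Fin N) : (uniformFin N).real {i} = 1 / N := by
  rw [uniformFin, map_measureReal_apply measurable_stepIndex (measurableSet_singleton i),
    volume_stepIndex_preimage]

theorem integral_stepIndex_pi (k : ℕ) (f : (Fin k → Fin N) → ℝ) :
    ∫ x : Fin k → unitInterval, f (fun i => stepIndex N (x i)) = (∑ c, f c) / (N : ℝ) ^ k := by
  have hmp : MeasurePreserving (fun (x : Fin k → unitInterval) i => stepIndex N (x i)) volume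
      (Measure.pi fun _ => uniformFin N) :=
    measurePreserving_pi _ _ fun _ => measurePreserving_stepIndex
  rw [← integral_map (f := f) hmp.measurable.aemeasurable
    (measurable_of_countable f).aestronglyMeasurable, hmp.map_eq, integral_fintype .of_finite,
    Finset.sum_div]
  refine Finset.sum_congr rfl fun c _ => ?_
  rw [measureReal_def, Measure.pi_singleton, ENNReal.toReal_prod]
  simp only [← measureReal_def, uniformFin_real_singleton]
  simp [div_eq_inv_mul]

theorem integral_stepIndex_prod (f : Fin N → Fin N → ℝ) :
    ∫ p : unitInterval × unitInterval, f (stepIndex N p.1) (stepIndex N p.2) =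
      (∑ i, ∑ j, f i j) / (N : ℝ) ^ 2 := by
  have hmp : MeasurePreserving (Prod.map (stepIndex N) (stepIndex N))
      (volume : Measure (unitInterval × unitInterval)) ((uniformFin N).prod (uniformFin N)) :=
    measurePreserving_stepIndex.prod measurePreserving_stepIndex
  have := integral_map (μ := volume) (f := fun q : Fin N × Fin N => f q.1 q.2) hmp.measurable.aemeasurable
    (measurable_of_countable _).aestronglyMeasurable
  rw [hmp.map_eq] at this
  refine this.symm.trans ?_
  rw [integral_fintype .of_finite, ← Fintype.sum_prod_type', Finset.sum_div]
  refine Finset.sum_congr rfl fun c _ => ?_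
  rw [← Set.singleton_prod_singleton (a := c.1) (b := c.2), measureReal_prod_prod, uniformFin_real_singleton,
    uniformFin_real_singleton]
  rw [smul_eq_mul]
  ring

end stepIndex

/-! ### Homomorphism densities as kernel densities -/

open Classical in
/-- The step kernel of a graph whose vertices are enumerated by `e`. -/
noncomputable def graphKernel {N : ℕ} [NeZero N] {V : Type*} (G : SimpleGraph V)
    (e : Fin N ≃ V) (x y : unitInterval) : ℝ :=
  if G.Adj (e (stepIndex N x)) (e (stepIndex N y)) then 1 else 0

section graphKernel

variable {N : ℕ} [NeZero N] {V : Type*} (G : SimpleGraph V) (e : Fin N ≃ V)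

theorem isKernel_graphKernel : IsKernel (graphKernel G e) := by
  classical
  refine ⟨?_, fun x y => ?_⟩
  · have h : Measurable fun q : Fin N × Fin N => if G.Adj (e q.1) (e q.2) then (1 : ℝ) else 0 :=
      measurable_of_countable _
    have h2 := h.comp ((measurable_stepIndex (N := N)).prodMap (measurable_stepIndex (N := N)))
    convert h2 using 1
    ext p
    simp [graphKernel, Function.uncurry]
  · unfold graphKernel
    split_ifs <;> simp

theorem graphKernel_symm (x y : unitInterval) : graphKernel G e x y = graphKernel G e y x := by
  classical
  exact if_congr (G.adj_comm _ _) rfl rfl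

theorem homDensity_eq_kernelDensity [Fintype V] (F : TestGraph) :
    homDensity F G = kernelDensity F (graphKernel G e) := by
  classical
  have hN : Fintype.card V = N := by simpa using (Fintype.card_congr e).symm
  have hprod : ∀ c : Fin F.1 → Fin N,
      (∏ d : Fin F.1 × Fin F.1 with d.1 < d.2 ∧ F.2.Adj d.1 d.2,
        if G.Adj (e (c d.1)) (e (c d.2)) then (1 : ℝ) else 0) =
      if ∀ a b, F.2.Adj a b → G.Adj (e (c a)) (e (c b)) then 1 else 0 := by
    intro c
    split_ifs with h
    · refine Finset.prod_eq_one fun d hd => if_pos ?_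
      exact h _ _ (Finset.mem_filter.1 hd).2.2
    · push Not at h
      obtain ⟨a, b, hab, hne⟩ := h
      rcases lt_or_gt_of_ne hab.ne with hlt | hlt
      · exact Finset.prod_eq_zero (i := (a, b)) (by simp [hlt, hab]) (if_neg hne)
      · exact Finset.prod_eq_zero (i := (b, a)) (by simp [hlt, hab.symm])
          (if_neg fun h' => hne (G.adj_symm h'))
  have hk : kernelDensity F (graphKernel G e) =
      (∑ c : Fin F.1 → Fin N, if ∀ a b, F.2.Adj a b → G.Adj (e (c a)) (e (c b))
        then (1 : ℝ) else 0) / (N : ℝ) ^ F.1 := by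
    rw [← integral_stepIndex_pi]
    unfold kernelDensity
    refine integral_congr_ae (ae_of_all _ fun x => ?_)
    dsimp only
    rw [← hprod]
    refine Finset.prod_congr (Finset.filter_congr_decidable _ _ _) fun d _ => ?_
    unfold graphKernel
    congr
  rw [hk, homDensity, hN, Finset.sum_boole]
  congr 2
  rw [← Fintype.card_subtype, ← Nat.card_eq_fintype_card]
  refine Nat.card_congr ⟨fun f => ⟨fun a => e.symm (f a), fun a b hab => ?_⟩,
    fun c => ⟨fun a => e (c.1 a), fun {a b} hab => c.2 a b hab⟩, fun f => ?_, fun c => ?_⟩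
  · simpa using f.map_adj hab
  · ext a; simp
  · ext a; simp

end graphKernel

/-! ### Degree distributions -/

section degree

variable {V : Type*} [Fintype V] [Nonempty V] (G : SimpleGraph V)

theorem integral_degreeDistribution {f : unitInterval → ℝ} (hf : Measurable f) :
    ∫ x, f x ∂(degreeDistribution G : Measure unitInterval) =
      (∑ v, f (normalizedDegree G v)) / Fintype.card V := by
  let _ : MeasurableSpace V := ⊤
  have hm : Measurable (normalizedDegree G) := fun _ _ => trivial
  have h : (degreeDistribution G : Measure unitInterval) =
      (PMF.uniformOfFintype V).toMeasure.map (normalizedDegree G) :=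
    (PMF.toMeasure_map _ _ hm).symm
  rw [h, integral_map hm.aemeasurable hf.aestronglyMeasurable, PMF.integral_eq_sum]
  simp [Finset.mul_sum, div_eq_inv_mul]

theorem leftCdf_degreeDistribution (s : unitInterval)
    [DecidablePred fun v => normalizedDegree G v < s] :
    leftCdf (degreeDistribution G) s =
      ({v | normalizedDegree G v < s} : Finset V).card / Fintype.card V := by
  rw [leftCdf_eq, ← integral_indicator_one measurableSet_Iio,
    integral_degreeDistribution G (measurable_one.indicator measurableSet_Iio),
    Finset.card_filter]
  simp [indicator_apply]

end degree

/-! ### Threshold graphs -/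

section threshold

variable {N : ℕ} {V : Type*} [Fintype V] (G : SimpleGraph V)

open Classical in
theorem degree_le_degree_of_weight_le {w : V → ℝ} {t : ℝ}
    (hw : ∀ i j : V, i ≠ j → (G.Adj i j ↔ w i + w j > t)) {a b : V} (hab : w a ≤ w b) :
    G.degree a ≤ G.degree b := by
  have hsub : (G.neighborFinset a).erase b ⊆ (G.neighborFinset b).erase a := by
    intro c hc
    simp only [Finset.mem_erase, SimpleGraph.mem_neighborFinset] at hc ⊢
    refine ⟨hc.2.ne', (hw b c hc.1.symm).2 ?_⟩
    have := (hw a c hc.2.ne).1 hc.2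
    linarith
  have hcard := Finset.card_le_card hsub
  rw [← SimpleGraph.card_neighborFinset_eq_degree, ← SimpleGraph.card_neighborFinset_eq_degree]
  by_cases h : G.Adj a b
  · rw [Finset.card_erase_of_mem (by simpa using h),
      Finset.card_erase_of_mem (by simpa using h.symm)] at hcard
    have h1 : 0 < (G.neighborFinset b).card :=
      Finset.card_pos.2 ⟨a, by simpa using h.symm⟩
    omega
  · rwa [Finset.erase_eq_of_notMem (by simpa using h),
      Finset.erase_eq_of_notMem (by simpa using fun h' => h (G.adj_symm h'))] at hcard

open Classical in
/-- In an enumeration by increasing weights, the neighbours of a vertex of degree `d` are, up to two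
vertices, the last `d` vertices. -/
theorem card_adj_ne_le_two {w : V → ℝ} {t : ℝ}
    (hw : ∀ i j : V, i ≠ j → (G.Adj i j ↔ w i + w j > t)) {e : Fin N ≃ V}
    (he : Monotone (w ∘ e)) (i : Fin N) :
    ({j | ¬ (G.Adj (e i) (e j) ↔ N ≤ j + G.degree (e i))} : Finset (Fin N)).card ≤ 2 := by
  set d := G.degree (e i) with hd
  let U : Finset (Fin N) := {j | w (e i) + w (e j) > t}
  let A : Finset (Fin N) := {j | G.Adj (e i) (e j)}
  let T : Finset (Fin N) := {j | N ≤ j + d}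
  have hN : Fintype.card V = N := by simpa using (Fintype.card_congr e).symm
  have hdN : d ≤ N := hN ▸ (G.degree_lt_card_verts (e i)).le
  have hA : A.card = d := by
    rw [hd, ← SimpleGraph.card_neighborFinset_eq_degree]
    refine Finset.card_bij (fun j _ => e j) (by simp [A]) (by simp) fun v hv => ?_
    exact ⟨e.symm v, by simpa [A] using hv, by simp⟩
  have hT : T.card = d := by
    rcases Nat.eq_zero_or_pos d with h0 | h0
    · rw [h0, Finset.card_eq_zero, Finset.filter_eq_empty_iff]
      intro j _
      omega
    · have : T = Finset.Ici (⟨N - d, by omega⟩ : Fin N) := by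
        ext j
        simp only [T, Finset.mem_filter, Finset.mem_univ, true_and, Finset.mem_Ici,
          Fin.le_def]
        omega
      rw [this, Fin.card_Ici]
      simp only
      omega
  have hAU : A ⊆ U := by
    intro j hj
    simp only [A, U, Finset.mem_filter, Finset.mem_univ, true_and] at hj ⊢
    exact (hw _ _ hj.ne).1 hj
  have hUA : U ⊆ insert i A := by
    intro j hj
    simp only [A, U, Finset.mem_filter, Finset.mem_univ, true_and, Finset.mem_insert] at hj ⊢
    by_cases h : j = i
    · exact .inl h
    · exact .inr ((hw _ _ fun h' => h (e.injective h').symm).2 hj)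
  have hUcard : U.card ≤ d + 1 :=
    (Finset.card_le_card hUA).trans ((Finset.card_insert_le _ _).trans (by rw [hA]))
  have hTU : T ⊆ U := by
    by_contra hne
    obtain ⟨j, hjT, hjU⟩ := Finset.not_subset.1 hne
    have hUT : U ⊂ T := by
      refine Finset.ssubset_iff_subset_ne.2 ⟨fun l hl => ?_, fun h => hjU (h ▸ hjT)⟩
      simp only [T, U, Finset.mem_filter, Finset.mem_univ, true_and, not_lt] at hl hjU hjT ⊢
      have : j ≤ l := by
        by_contra! hlj
        have := he hlj.le
        simp only [Function.comp] at this
        linarith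
      have : (j : ℕ) ≤ l := this
      omega
    have h1 := Finset.card_lt_card hUT
    have h2 := Finset.card_le_card hAU
    omega
  calc _ ≤ ((U \ A) ∪ (U \ T)).card := by
        refine Finset.card_le_card fun j hj => ?_
        have h1 : j ∈ A → j ∈ U := fun h => hAU h
        have h2 : j ∈ T → j ∈ U := fun h => hTU h
        simp only [Finset.mem_filter, Finset.mem_univ, true_and, Finset.mem_union,
          Finset.mem_sdiff, A, T] at hj h1 h2 ⊢
        tauto
    _ ≤ (U \ A).card + (U \ T).card := Finset.card_union_le _ _
    _ ≤ 2 := by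
        rw [Finset.card_sdiff_of_subset hAU, Finset.card_sdiff_of_subset hTU]
        omega

open Classical in
theorem thresholdKernel_degreeDistribution [NeZero N] [Nonempty V] {e : Fin N ≃ V}
    (he : Monotone fun i => G.degree (e i)) {x y : unitInterval} (hx : x ≠ 1) (hy : y ≠ 1) :
    thresholdKernel (degreeDistribution G) x y =
      if N ≤ (stepIndex N y : ℕ) + G.degree (e (stepIndex N x)) then 1 else 0 := by
  have hN0 : (0 : ℝ) < N := by exact_mod_cast NeZero.pos N
  have hN : Fintype.card V = N := by simpa using (Fintype.card_congr e).symm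
  rw [thresholdKernel_eq_ite]
  refine if_congr ?_ rfl rfl
  rw [leftCdf_degreeDistribution, hN, div_le_iff₀ hN0, mul_comm (x : ℝ),
    ← Nat.le_floor_iff (mul_nonneg hN0.le x.2.1), ← stepIndex_val hx]
  set i := stepIndex N x
  have hlt : ∀ l : Fin N, normalizedDegree G (e l) < unitInterval.symm y ↔
      (stepIndex N y : ℕ) + G.degree (e l) < N := by
    intro l
    have hdN : G.degree (e l) ≤ N := hN ▸ (G.degree_lt_card_verts (e l)).le
    rw [← Subtype.coe_lt_coe, unitInterval.coe_symm_eq]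
    simp only [normalizedDegree, hN]
    rw [div_lt_iff₀ hN0, stepIndex_val hy, ← Nat.lt_sub_iff_add_lt,
      Nat.floor_lt (mul_nonneg hN0.le y.2.1), Nat.cast_sub hdN]
    constructor <;> intro h <;> linarith
  have hcard : ({v | normalizedDegree G v < unitInterval.symm y} : Finset V).card =
      ({l | (stepIndex N y : ℕ) + G.degree (e l) < N} : Finset (Fin N)).card := by
    refine (Finset.card_bij (fun l _ => e l) (fun l hl => ?_) (by simp) fun v hv => ?_).symm
    · simpa [hlt] using hl
    · refine ⟨e.symm v, ?_, by simp⟩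
      rw [Finset.mem_filter, ← hlt]
      simpa using hv
  rw [hcard]
  constructor
  · intro h
    by_contra! hi
    have hsub : Finset.Iic i ⊆
        ({l | (stepIndex N y : ℕ) + G.degree (e l) < N} : Finset (Fin N)) := by
      intro l hl
      have := he (Finset.mem_Iic.1 hl)
      simp only [Finset.mem_filter, Finset.mem_univ, true_and] at this ⊢
      omega
    have := Finset.card_le_card hsub
    rw [Fin.card_Iic] at this
    omega
  · intro h
    have hsub : ({l | (stepIndex N y : ℕ) + G.degree (e l) < N} : Finset (Fin N)) ⊆
        Finset.Iio i := by
      intro l hl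
      rw [Finset.mem_Iio]
      by_contra! hil
      have := he hil
      simp only [Finset.mem_filter, Finset.mem_univ, true_and] at this hl
      omega
    have := Finset.card_le_card hsub
    rwa [Fin.card_Iio] at this

theorem IsThresholdGraph.exists_kernelDist_le [Nonempty V] {G : SimpleGraph V}
    (hG : IsThresholdGraph G) :
    ∃ A, IsKernel A ∧ (∀ x y, A x y = A y x) ∧ (∀ F, homDensity F G = kernelDensity F A) ∧
      kernelDist A (thresholdKernel (degreeDistribution G)) ≤ 2 / Fintype.card V := by
  classical
  obtain ⟨w, t, hw⟩ := hG
  have : NeZero (Fintype.card V) := ⟨Fintype.card_ne_zero⟩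
  let e₀ := (Fintype.equivFin V).symm
  let e : Fin (Fintype.card V) ≃ V := (Tuple.sort (w ∘ e₀)).trans e₀
  have he : Monotone (w ∘ e) := Tuple.monotone_sort (w ∘ e₀)
  have hd : Monotone fun i => G.degree (e i) :=
    fun i j hij => degree_le_degree_of_weight_le G hw (he hij)
  refine ⟨graphKernel G e, isKernel_graphKernel G e, graphKernel_symm G e,
    homDensity_eq_kernelDensity G e, ?_⟩
  let f : Fin (Fintype.card V) → Fin (Fintype.card V) → ℝ := fun i j =>
    if ¬ (G.Adj (e i) (e j) ↔ Fintype.card V ≤ j + G.degree (e i)) then 1 else 0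
  have hf : kernelDist (graphKernel G e) (thresholdKernel (degreeDistribution G)) =
      ∫ p : unitInterval × unitInterval, f (stepIndex _ p.1) (stepIndex _ p.2) := by
    refine integral_congr_ae ?_
    filter_upwards [Measure.quasiMeasurePreserving_fst.ae ae_ne_one,
      Measure.quasiMeasurePreserving_snd.ae ae_ne_one] with p hp1 hp2
    rw [thresholdKernel_degreeDistribution G hd hp1 hp2]
    simp only [graphKernel, f]
    split_ifs <;> simp_all
  rw [hf, integral_stepIndex_prod]
  have hN0 : (0 : ℝ) < Fintype.card V := by exact_mod_cast Fintype.card_pos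
  calc _ ≤ (∑ _i : Fin (Fintype.card V), (2 : ℝ)) / (Fintype.card V : ℝ) ^ 2 := by
        gcongr with i
        simp only [f]
        rw [Finset.sum_boole]
        exact_mod_cast card_adj_ne_le_two G hw he i
    _ = _ := by
        simp only [Finset.sum_const, Finset.card_univ, Fintype.card_fin, nsmul_eq_mul]
        field_simp

end threshold

/-! ### Moments -/

/-- The star with centre `0` and `k` leaves. -/
def starTestGraph (k : ℕ) : TestGraph :=
  ⟨k + 1, { Adj := fun a b => a ≠ b ∧ (a = 0 ∨ b = 0)
            symm := ⟨fun _ _ h => ⟨h.1.symm, h.2.symm⟩⟩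
            loopless := ⟨fun _ h => h.1 rfl⟩ }⟩

open Classical in
theorem card_hom_starTestGraph {V : Type*} [Fintype V] (G : SimpleGraph V) (k : ℕ) :
    Nat.card ((starTestGraph k).2 →g G) = ∑ v, G.degree v ^ k := by
  have e : ((starTestGraph k).2 →g G) ≃ Σ v : V, (Fin k → G.neighborSet v) :=
    { toFun := fun f => ⟨f (0 : Fin (k + 1)), fun i => ⟨f i.succ,
        f.map_adj (show (0 : Fin (k + 1)) ≠ i.succ ∧ _ from ⟨i.succ_ne_zero.symm, .inl rfl⟩)⟩⟩
      invFun := fun c => ⟨(Fin.cons c.1 fun i => (c.2 i : V) : Fin (k + 1) → V), by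
        rintro a b ⟨hab, h | h⟩
        · subst h
          obtain ⟨j, rfl⟩ := Fin.exists_succ_eq.2 hab.symm
          exact (c.2 j).2
        · subst h
          obtain ⟨j, rfl⟩ := Fin.exists_succ_eq.2 hab
          exact G.adj_symm (c.2 j).2⟩
      left_inv := fun f => by
        ext a
        refine Fin.cases ?_ (fun i => ?_) a <;> rfl
      right_inv := fun c => rfl }
  rw [Nat.card_congr e, Nat.card_eq_fintype_card, Fintype.card_sigma]
  refine Finset.sum_congr rfl fun v _ => ?_
  rw [Fintype.card_fun, G.card_neighborSet_eq_degree, Fintype.card_fin]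

theorem homDensity_starTestGraph {V : Type*} [Fintype V] [Nonempty V] (G : SimpleGraph V)
    (k : ℕ) : homDensity (starTestGraph k) G =
      ∫ x, (x : ℝ) ^ k ∂(degreeDistribution G : Measure unitInterval) := by
  rw [integral_degreeDistribution G (measurable_subtype_coe.pow_const k), homDensity,
    card_hom_starTestGraph]
  simp only [normalizedDegree, div_pow, ← Finset.sum_div]
  rw [div_div, ← pow_succ]
  push_cast
  rfl

open scoped BoundedContinuousFunction in
theorem ext_of_forall_moment_eq {μ ν : Measure unitInterval} [IsFiniteMeasure μ]
    [IsFiniteMeasure ν] (h : ∀ k : ℕ, ∫ x, (x : ℝ) ^ k ∂μ = ∫ x, (x : ℝ) ^ k ∂ν) : μ = ν := by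
  let A : StarSubalgebra ℝ (unitInterval →ᵇ ℝ) :=
    { carrier := {g | ∃ p : Polynomial ℝ, ∀ x, g x = p.eval (x : ℝ)}
      mul_mem' := by
        rintro f g ⟨p, hp⟩ ⟨q, hq⟩
        exact ⟨p * q, fun x => by simp [hp, hq]⟩
      add_mem' := by
        rintro f g ⟨p, hp⟩ ⟨q, hq⟩
        exact ⟨p + q, fun x => by simp [hp, hq]⟩
      algebraMap_mem' := fun r => ⟨.C r, fun x => by simp⟩
      star_mem' := by
        rintro f ⟨p, hp⟩
        exact ⟨p, fun x => by simp [hp]⟩ }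
  refine ext_of_forall_mem_subalgebra_integral_eq_of_polish (𝕜 := ℝ) (A := A) ?_ ?_
  · intro x y hxy
    let g : unitInterval →ᵇ ℝ :=
      BoundedContinuousFunction.mkOfCompact ⟨fun x => (x : ℝ), continuous_subtype_val⟩
    have hg : g ∈ A := ⟨.X, fun x => by simp [g]⟩
    exact ⟨fun x => g x, ⟨_, ⟨g, hg, rfl⟩, rfl⟩, fun h' => hxy (Subtype.ext h')⟩
  · rintro g ⟨p, hp⟩
    have key : ∀ (ρ : Measure unitInterval) [IsFiniteMeasure ρ],
        ∫ x, g x ∂ρ = ∑ i ∈ Finset.range (p.natDegree + 1), p.coeff i * ∫ x, (x : ℝ) ^ i ∂ρ := by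
      intro ρ _
      simp only [hp, Polynomial.eval_eq_sum_range]
      rw [integral_finsetSum]
      · simp only [integral_const_mul]
      · intro i _
        refine Continuous.integrable_of_hasCompactSupport (by fun_prop) ?_
        exact HasCompactSupport.of_compactSpace _
    rw [key μ, key ν]
    simp only [h]

theorem tendsto_of_tendsto_moment {ν : ℕ → ProbabilityMeasure unitInterval} {m : ℕ → ℝ}
    (h : ∀ k, Tendsto (fun n => ∫ x, (x : ℝ) ^ k ∂(ν n : Measure unitInterval)) atTop (𝓝 (m k))) :
    ∃ μ, Tendsto ν atTop (𝓝 μ) := by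
  have hcont : ∀ k : ℕ, Continuous fun μ : ProbabilityMeasure unitInterval =>
      ∫ x, (x : ℝ) ^ k ∂(μ : Measure unitInterval) := fun k =>
    ProbabilityMeasure.continuous_integral_boundedContinuousFunction
      (BoundedContinuousFunction.mkOfCompact
        ⟨fun x : unitInterval => (x : ℝ) ^ k, by fun_prop⟩)
  have hm : ∀ μ, MapClusterPt μ atTop ν → ∀ k,
      ∫ x, (x : ℝ) ^ k ∂(μ : Measure unitInterval) = m k := fun μ hμ k =>
    eq_of_nhds_neBot (NeBot.mono (hμ.continuousAt_comp (hcont k).continuousAt)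
      (inf_le_inf_left _ (h k)))
  obtain ⟨μ, hμ⟩ := exists_clusterPt_of_compactSpace (map ν atTop)
  refine ⟨μ, le_nhds_of_unique_clusterPt fun μ' hμ' => Subtype.ext ?_⟩
  have := μ.2
  have := μ'.2
  exact ext_of_forall_moment_eq fun k => (hm μ' hμ' k).trans (hm μ hμ k).symm

theorem graphPoint_mem_graphCompletion {V : Type*} [Fintype V] [Nonempty V]
    (G : SimpleGraph V) : graphPoint G ∈ graphCompletion := by
  refine subset_closure ?_
  obtain ⟨m, hm⟩ := Nat.exists_eq_succ_of_ne_zero (Fintype.card_ne_zero (α := V))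
  let e : Fin (m + 1) ≃ V := (Fintype.equivFinOfCardEq hm).symm
  refine ⟨m, G.comap e, Prod.ext (funext fun F => ?_) ?_⟩
  · change homDensity F G = homDensity F (G.comap e)
    rw [homDensity_eq_kernelDensity G e, homDensity_eq_kernelDensity (G.comap e) (.refl _)]
    rfl
  · simp [graphPoint, hm]

theorem IsThresholdGraph.tendsto_kernelDist {V : ℕ → Type*} [∀ n, Fintype (V n)]
    [∀ n, Nonempty (V n)] {G : ∀ n, SimpleGraph (V n)} (hG : ∀ n, IsThresholdGraph (G n))
    (hv : Tendsto (fun n => Fintype.card (V n)) atTop atTop) {μ : ProbabilityMeasure unitInterval}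
    (hμ : Tendsto (fun n => degreeDistribution (G n)) atTop (𝓝 μ)) :
    ∃ A : ℕ → unitInterval → unitInterval → ℝ, (∀ n, IsKernel (A n)) ∧
      (∀ n x y, A n x y = A n y x) ∧ (∀ n F, homDensity F (G n) = kernelDensity F (A n)) ∧
      Tendsto (fun n => kernelDist (A n) (thresholdKernel μ)) atTop (𝓝 0) := by
  choose A hA hsymm hdens hdist using fun n => (hG n).exists_kernelDist_le
  refine ⟨A, hA, hsymm, hdens, squeeze_zero (fun _ => kernelDist_nonneg _ _)
    (fun n => ((hA n).kernelDist_triangle (isKernel_thresholdKernel (degreeDistribution (G n)))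
      (isKernel_thresholdKernel μ)).trans (add_le_add_left (hdist n) _)) ?_⟩
  have h1 : Tendsto (fun n => 2 / (Fintype.card (V n) : ℝ)) atTop (𝓝 0) :=
    (tendsto_natCast_atTop_atTop.comp hv).const_div_atTop 2
  simpa using h1.add (tendsto_kernelDist_thresholdKernel hμ)

theorem theorem5p6 {V : ℕ → Type*} [∀ n, Fintype (V n)] [∀ n, Nonempty (V n)]
    (G : ∀ n, SimpleGraph (V n)) (hG : ∀ n, IsThresholdGraph (G n))
    (hv : Tendsto (fun n => Fintype.card (V n)) atTop atTop) :
    ((∃ Γ : GraphSpace, GraphsConvergeTo G Γ) ↔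
      ∃ μ : ProbabilityMeasure unitInterval,
        Tendsto (fun n => degreeDistribution (G n)) atTop (𝓝 μ)) ∧
    ∀ μ : ProbabilityMeasure unitInterval,
      Tendsto (fun n => degreeDistribution (G n)) atTop (𝓝 μ) →
        μ ∈ symmetricMeasures ∧ GraphsConvergeTo G (thresholdLimit μ) := by
  have main : ∀ μ : ProbabilityMeasure unitInterval,
      Tendsto (fun n => degreeDistribution (G n)) atTop (𝓝 μ) →
        μ ∈ symmetricMeasures ∧ GraphsConvergeTo G (thresholdLimit μ) := by
    intro μ hμ
    obtain ⟨A, hA, hsymm, hdens, hdist⟩ := IsThresholdGraph.tendsto_kernelDist hG hv hμ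
    have hW := isKernel_thresholdKernel μ
    constructor
    · refine mem_symmetricMeasures_of_kernelDist_eq_zero
        (le_antisymm (ge_of_tendsto' (by simpa using hdist.add hdist) fun n => ?_)
          (kernelDist_nonneg _ _))
      have hflip : kernelDist (A n) (fun x y => thresholdKernel μ y x) =
          kernelDist (A n) (thresholdKernel μ) := by
        rw [← kernelDist_flip]
        congr 1
        ext x y
        exact hsymm n y x
      calc _ ≤ kernelDist (thresholdKernel μ) (A n) +
            kernelDist (A n) (fun x y => thresholdKernel μ y x) :=
            hW.kernelDist_triangle (hA n) hW.flip
        _ = _ := by rw [hflip, kernelDist_comm]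
    · have ht : Tendsto (fun n => graphPoint (G n)) atTop (𝓝 (thresholdLimit μ)) := by
        refine Tendsto.prodMk_nhds (tendsto_pi_nhds.2 fun F => ?_)
          ((tendsto_natCast_atTop_atTop.comp hv).const_div_atTop 1)
        obtain ⟨C, hC⟩ := exists_abs_kernelDensity_sub_le F
        rw [tendsto_iff_dist_tendsto_zero]
        refine squeeze_zero (fun _ => dist_nonneg) (fun n => ?_)
          (by simpa using hdist.const_mul C)
        rw [hdens, Real.dist_eq]
        exact hC _ _ (hA n) hW
      exact ⟨isClosed_closure.mem_of_tendsto ht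
        (.of_forall fun n => graphPoint_mem_graphCompletion (G n)), ht⟩
  refine ⟨⟨?_, fun ⟨μ, hμ⟩ => ⟨_, (main μ hμ).2⟩⟩, main⟩
  rintro ⟨Γ, -, hΓ⟩
  refine tendsto_of_tendsto_moment (m := fun k => Γ.1 (starTestGraph k)) fun k => ?_
  simp only [← homDensity_starTestGraph]
  exact tendsto_pi_nhds.1 ((continuous_fst.tendsto _).comp hΓ) (starTestGraph k)
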